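/- Cascading bandit. Let $1\le K\le L$ be integers and let $\boldsymbol w=(w(1),\dots,w(L))\in[0,1]^L$ be unknown click probabilities. In each round $t=1,2,\dots$ the agent shows a list $S_t=(i_1^t,\dots,i_K^t)$ of $K$ distinct items of $[L]=\{1,\dots,L\}$. The click indicators $W_t(i)\sim\mathrm{Bern}(w(i))$, $i\in[L]$, are independent over items and rounds, and those of round $t$ are independent of everything that determined $S_t$. With $k_t=\min\{1\le k\le K: W_t(i_k^t)=1\}$ ($\min\emptyset=\infty$), the agent observes $W_t(i^t_k)$ exactly for $k\le\min\{k_t,K\}$. The expected reward of a list $S=(i_1,\dots,i_K)$ is $r(S\mid\boldsymbol w)=1-\prod_{k=1}^K(1-w(i_k))$, $S^*$ is a list of $K$ distinct items maximizing it, and the cumulative regret is $$\mathrm{Reg}(T)=T\cdot r(S^*\mid\boldsymbol w)-\sum_{t=1}^T r(S_t\mid\boldsymbol w).$$ Algorithm TS-Cascade. Start with $\hat w_1(i)=0$ and $N_1(i)=0$ for all $i\in[L]$. In round $t$, draw one standard normal seed $Z_t\sim\mathcal N(0,1)$, independent of the past and shared by all items; for every $i\in[L]$ put $\hat\nu_t(i)=\hat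 w_t(i)(1-\hat w_t(i))$, $$\sigma_t(i)=\max\left\{\sqrt{\frac{\hat\nu_t(i)\log(t+1)}{N_t(i)+1}},\ \frac{\log(t+1)}{N_t(i)+1}\right\},\qquad \theta_t(i)=\hat w_t(i)+Z_t\,\sigma_t(i);$$ for $k=1,\dots,K$ choose $i_k^t\in\operatorname{argmax}_{i\in[L]\setminus\{i_1^t,\dots,i_{k-1}^t\}}\theta_t(i)$ (ties are broken arbitrarily, without knowledge of the clicks of the current and later rounds or of later seeds), and show $S_t=(i_1^t,\dots,i_K^t)$. For every item $i$ whose $W_t(i)$ is observed set $\hat w_{t+1}(i)=\frac{N_t(i)\hat w_t(i)+W_t(i)}{N_t(i)+1}$ and $N_{t+1}(i)=N_t(i)+1$; for all other items $\hat w_{t+1}(i)=\hat w_t(i)$ and $N_{t+1}(i)=N_t(i)$. Theorem. There is an absolute constant $C>0$, independent of $K$, $L$, $T$ and $\boldsymbol w$, such that for all integers $1\le K\le L$ and $T\ge 2$ and all $\boldsymbol w\in[0,1]^L$, the expected cumulative regret of TS-Cascade satisfies $$\mathbb E[\mathrm{Reg}(T)]\le C\left(\sqrt{KLT}\,\log T+L\,\log^{5/2}T\right).$$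 -/

import Mathlib

open MeasureTheory ProbabilityTheory

noncomputable section

namespace CascadingBandit

variable {L K : ℕ}

/-! ## The cascading bandit model

Items are elements of `Fin L`. A recommendation list is a function `S : Fin K → Fin L` (injective for
lists without repetition), and a click realization of one round is `W : Fin L → Bool`. -/

/-- Expected instantaneous reward `r(S | w) = 1 - ∏ₖ (1 - w(iₖ))` of the list `S = (i₁, …, i_K)`. -/
def expectedReward (w : Fin L → ℝ) (S : Fin K → Fin L) : ℝ :=
  1 - ∏ k, (1 - w (S k))

/-- The largest expected instantaneous reward `r(S* | w)` over all lists of `K` distinct items. -/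
def optimalReward (K : ℕ) (w : Fin L → ℝ) : ℝ :=
  ⨆ S : Fin K ↪ Fin L, expectedReward w S

/-- Position of the first clicked item of the list, `⊤` (playing the role of `∞`) if there is none. -/
def clickPosition (S : Fin K → Fin L) (W : Fin L → Bool) : WithTop (Fin K) :=
  (Finset.univ.filter fun k => W (S k) = true).min

/-- The click indicator of item `i` is observed: `i` stands in the list, not after the first click. -/
def Observed (S : Fin K → Fin L) (W : Fin L → Bool) (i : Fin L) : Prop :=
  ∃ k : Fin K, S k = i ∧ (k : WithTop (Fin K)) ≤ clickPosition S W

/-- Cumulative regret `T · r(S* | w) - ∑_{t=1}^T r(S_t | w)` of the lists `S 1, S 2, …`. -/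
def regret (w : Fin L → ℝ) (S : ℕ → Fin K → Fin L) (T : ℕ) : ℝ :=
  T * optimalReward K w - ∑ t ∈ Finset.Icc 1 T, expectedReward w (S t)

/-! ## The algorithm TS-Cascade -/

/-- The statistics kept by the algorithm: the empirical mean `ŵ(i)` and the number of observations
`N(i)` of every item `i`. -/
structure Stats (L : ℕ) where
  mean : Fin L → ℝ
  count : Fin L → ℕ

/-- Initial statistics: `ŵ₁(i) = 0` and `N₁(i) = 0`. -/
def Stats.init (L : ℕ) : Stats L where
  mean := fun _ => 0
  count := fun _ => 0

open Classical in
/-- Update of the statistics after list `S` was shown and `W` was the click realization. -/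
def Stats.update (s : Stats L) (S : Fin K → Fin L) (W : Fin L → Bool) : Stats L where
  mean := fun i =>
    if Observed S W i then
      ((s.count i : ℝ) * s.mean i + (if W i = true then 1 else 0)) / ((s.count i : ℝ) + 1)
    else s.mean i
  count := fun i => if Observed S W i then s.count i + 1 else s.count i

/-- Statistics at the start of round `t`, for the lists `S` and the click realizations `W`. Rounds are
numbered from `1`; the value at `0` is a convention and `S 0`, `W 0` are never used. -/
def stats (S : ℕ → Fin K → Fin L) (W : ℕ → Fin L → Bool) : ℕ → Stats L
  | 0 => Stats.init L
  | 1 => Stats.init L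
  | t + 2 => (stats S W (t + 1)).update (S (t + 1)) (W (t + 1))

/-- Empirical variance `ν̂(i) = ŵ(i) (1 - ŵ(i))`. -/
def Stats.empVar (s : Stats L) (i : Fin L) : ℝ :=
  s.mean i * (1 - s.mean i)

/-- Standard deviation `σ_t(i)` of the Thompson sample of item `i` in round `t`. -/
def Stats.stdDev (s : Stats L) (t : ℕ) (i : Fin L) : ℝ :=
  max (Real.sqrt (s.empVar i * Real.log ((t : ℝ) + 1) / ((s.count i : ℝ) + 1)))
    (Real.log ((t : ℝ) + 1) / ((s.count i : ℝ) + 1))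

/-- Thompson sample `θ_t(i) = ŵ_t(i) + z σ_t(i)`; the seed `z` is shared by all items. -/
def Stats.thompson (s : Stats L) (t : ℕ) (z : ℝ) (i : Fin L) : ℝ :=
  s.mean i + z * s.stdDev t i

/-- `S = (i₁, …, i_K)` is a possible output of the greedy selection for the scores `θ`: for every `k`,
`i_k` belongs to `argmax {θ i | i ∈ [L] \ {i₁, …, i_{k-1}}}`. Ties may be broken in any way. -/
def IsGreedyList (θ : Fin L → ℝ) (S : Fin K → Fin L) : Prop :=
  ∀ k, (∀ j < k, S j ≠ S k) ∧ ∀ i, (∀ j < k, S j ≠ i) → θ i ≤ θ (S k)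

variable {Ω : Type*}

/-- The σ-algebra generated by the seeds, lists and click realizations of the rounds `1, …, t - 1`. -/
abbrev past (Z : ℕ → Ω → ℝ) (S : ℕ → Ω → Fin K → Fin L) (W : ℕ → Ω → Fin L → Bool) (t : ℕ) :
    MeasurableSpace Ω :=
  ⨆ s ∈ Finset.Ico 1 t,
    (MeasurableSpace.comap (Z s) inferInstance ⊔ MeasurableSpace.comap (S s) inferInstance ⊔
      MeasurableSpace.comap (W s) inferInstance)

/-- TS-Cascade, run on the cascading bandit with click probabilities `w`: in round `t ≥ 1` the seed
`Z t` is drawn from `N(0, 1)` independently of the past, the list `S t` is selected greedily from the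
Thompson samples, and the clicks `W t` are independent Bernoulli variables with means `w i`, independent
of the past, of the seed and of the chosen list. Ties in the selection are broken arbitrarily, possibly
at random, but without knowledge of the clicks of the current and later rounds and of later seeds. -/
structure IsTSCascade [MeasurableSpace Ω] (μ : Measure Ω) (w : Fin L → ℝ) (Z : ℕ → Ω → ℝ)
    (S : ℕ → Ω → Fin K → Fin L) (W : ℕ → Ω → Fin L → Bool) : Prop where
  measurable_seed : ∀ t, 1 ≤ t → Measurable (Z t)
  measurable_list : ∀ t, 1 ≤ t → Measurable (S t)
  measurable_click : ∀ t, 1 ≤ t → Measurable (W t)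
  seed_law : ∀ t, 1 ≤ t → μ.map (Z t) = gaussianReal 0 1
  seed_indep : ∀ t, 1 ≤ t → Indep (past Z S W t) (MeasurableSpace.comap (Z t) inferInstance) μ
  list_greedy : ∀ t, 1 ≤ t → ∀ ω,
    IsGreedyList ((stats (fun s => S s ω) (fun s => W s ω) t).thompson t (Z t ω)) (S t ω)
  click_law : ∀ t, 1 ≤ t → ∀ i, μ {ω | W t ω i = true} = ENNReal.ofReal (w i)
  click_iIndep : ∀ t, 1 ≤ t → iIndepFun (fun (i : Fin L) (ω : Ω) => W t ω i) μ
  click_indep : ∀ t, 1 ≤ t →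
    Indep (past Z S W t ⊔ MeasurableSpace.comap (Z t) inferInstance ⊔
      MeasurableSpace.comap (S t) inferInstance) (MeasurableSpace.comap (W t) inferInstance) μ

end CascadingBandit

end

namespace CascadingBandit

variable {L K : ℕ}

/-! ### Greedy lists and rewards -/

/-! Fix a round and suppose that every empirical mean is within `64` standard deviations of the
truth and that the seed is `O(√log t)`; the exceptions cost `O(L / t²)`. The seed is shared, so on
the event that it lies in `[64, 65]`, of constant probability `p`, all Thompson samples are
optimistic at once. A greedy list maximizes the reward of its own truncated scores, so comparing the
shown list `S` with a greedy list `S'` for such an optimistic seed bounds the gap by `width(S) + 2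
width(S')` (`optimalReward_sub_expectedReward_le`). Here `width` sums confidence widths weighted by
the probability of reaching each position.

Take `S'` of least width among the greedy lists for seeds in `[64, 65]`. It depends only on the
past, whereas the shown list is itself a candidate with probability `p`, independently of the past.
Hence `p · E width(S') ≤ E width(S)` (`integral_optimistic_le`), and only the width of the shown
list remains.

The weights are the conditional probabilities of observation, so in expectation they become
indicators of observation (`integral_sum_reachProb`). Each observation raises a count, so the widths
add up to sums of `1/√n` and `1/n`; since all counts together are at most `KT`, Cauchy–Schwarz gives
`√(KLT) log T`, and the harmonic sums give `L log^{5/2} T`.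

The accuracy of the means (`measure_not_accurate_le`) comes from an exponential supermartingale and
Bernstein's inequality, with the true variance then exchanged for the empirical one. -/

lemma IsGreedyList.injective {θ : Fin L → ℝ} {S : Fin K → Fin L} (h : IsGreedyList θ S) :
    Function.Injective S := by
  intro a b hab
  rcases lt_trichotomy a b with hlt | heq | hlt
  · exact absurd hab ((h b).1 a hlt)
  · exact heq
  · exact absurd hab.symm ((h a).1 b hlt)

lemma exists_isGreedyList (hKL : K ≤ L) (θ : Fin L → ℝ) : ∃ S : Fin K → Fin L, IsGreedyList θ S := by
  refine ⟨fun k => Tuple.sort (fun i => -θ i) (Fin.castLE hKL k), fun k => ⟨fun j hj hjk => ?_, fun i hi => ?_⟩⟩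
  · have := (Tuple.sort fun i => -θ i).injective hjk
    simp only [Fin.ext_iff, Fin.val_castLE] at this
    exact absurd (Fin.ext this) hj.ne
  · obtain ⟨l, rfl⟩ := (Tuple.sort fun i => -θ i).surjective i
    have hl : Fin.castLE hKL k ≤ l := by
      by_contra! hlt
      have hlK : (l : ℕ) < K := lt_of_lt_of_le (show (l : ℕ) < k from hlt) k.2.le
      exact hi ⟨l, hlK⟩ hlt rfl
    have := Tuple.monotone_sort (fun i => -θ i) hl
    simpa using this

lemma IsGreedyList.le_of_notMem {θ : Fin L → ℝ} {S : Fin K → Fin L} (h : IsGreedyList θ S)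
    {i : Fin L} (hi : ∀ k, S k ≠ i) (k : Fin K) : θ i ≤ θ (S k) :=
  (h k).2 i fun j _ => hi j

/-- Truncation to the unit interval. -/
noncomputable def clip (x : ℝ) : ℝ := max 0 (min 1 x)

lemma clip_mono {x y : ℝ} (h : x ≤ y) : clip x ≤ clip y :=
  max_le_max le_rfl (min_le_min le_rfl h)

lemma clip_nonneg (x : ℝ) : 0 ≤ clip x := le_max_left _ _

lemma clip_le_one (x : ℝ) : clip x ≤ 1 := max_le zero_le_one (min_le_left _ _)

lemma clip_of_mem {x : ℝ} (h0 : 0 ≤ x) (h1 : x ≤ 1) : clip x = x := by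
  simp [clip, h0, h1]

lemma abs_clip_sub_le {x y : ℝ} (h0 : 0 ≤ y) (h1 : y ≤ 1) : |clip x - y| ≤ |x - y| := by
  unfold clip
  rcases le_total 1 x with h | h <;> rcases le_total 0 x with h' | h' <;>
    simp only [h, h', min_eq_left, min_eq_right, max_eq_left, max_eq_right, zero_le_one] <;>
    first
    | exact le_rfl
    | linarith
    | (rw [abs_le]; constructor <;> cases abs_cases (x - y) <;> linarith)

/-- A greedy list maximizes the expected reward for the truncated scores. -/
lemma IsGreedyList.expectedReward_clip_le {θ : Fin L → ℝ} {S S' : Fin K → Fin L}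
    (h : IsGreedyList θ S) (hS' : Function.Injective S') :
    expectedReward (fun i => clip (θ i)) S' ≤ expectedReward (fun i => clip (θ i)) S := by
  classical
  have hS := h.injective
  set v : Fin L → ℝ := fun i => 1 - clip (θ i) with hv
  have hv0 : ∀ i, 0 ≤ v i := fun i => sub_nonneg.2 (clip_le_one _)
  suffices hle : ∏ k, v (S k) ≤ ∏ k, v (S' k) from sub_le_sub_left hle 1
  set A := Finset.univ.image S
  set B := Finset.univ.image S'
  have hA : ∏ k, v (S k) = ∏ i ∈ A, v i := (Finset.prod_image fun _ _ _ _ e => hS e).symm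
  have hB : ∏ k, v (S' k) = ∏ i ∈ B, v i := (Finset.prod_image fun _ _ _ _ e => hS' e).symm
  have hcard : A.card = B.card := by
    rw [Finset.card_image_of_injective _ hS, Finset.card_image_of_injective _ hS']
  have hcard' := Finset.card_sdiff_comm hcard
  rw [hA, hB, ← Finset.prod_inter_mul_prod_sdiff A B, ← Finset.prod_inter_mul_prod_sdiff B A,
    Finset.inter_comm B A]
  refine mul_le_mul_of_nonneg_left ?_ (Finset.prod_nonneg fun i _ => hv0 i)
  -- Common items cancel. Every item outside `S` scores at most as much as every item in `S`, so an
  -- arbitrary matching of the remaining items compares the factors.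
  have e := Finset.equivOfCardEq hcard'
  rw [← Finset.prod_coe_sort (A \ B), ← Finset.prod_coe_sort (B \ A),
    ← Equiv.prod_comp e (fun i => v (i : Fin L))]
  refine Finset.prod_le_prod (fun i _ => hv0 _) fun i _ => ?_
  obtain ⟨hiA, -⟩ := Finset.mem_sdiff.1 i.2
  obtain ⟨-, hjA⟩ := Finset.mem_sdiff.1 (e i).2
  obtain ⟨k, -, hk⟩ := Finset.mem_image.1 hiA
  rw [← hk]
  refine sub_le_sub_left (clip_mono (h.le_of_notMem (fun l hl => hjA ?_) k)) 1
  exact Finset.mem_image.2 ⟨l, Finset.mem_univ _, hl⟩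

/-- The probability that none of the items before position `k` is clicked. -/
noncomputable def reachProb (w : Fin L → ℝ) (S : Fin K → Fin L) (k : Fin K) : ℝ :=
  ∏ j with j < k, (1 - w (S j))

lemma reachProb_nonneg {w : Fin L → ℝ} (hw : ∀ i, w i ∈ Set.Icc (0 : ℝ) 1) (S : Fin K → Fin L)
    (k : Fin K) : 0 ≤ reachProb w S k :=
  Finset.prod_nonneg fun _ _ => sub_nonneg.2 (hw _).2

/-- The scores are exchanged one position at a time: the term at `k` has factors of `w` before `k`,
which form the reach probability, and factors of `u` after `k`, which are at most `1`. -/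
lemma abs_expectedReward_sub_le {w u : Fin L → ℝ} (hw : ∀ i, w i ∈ Set.Icc (0 : ℝ) 1)
    (hu : ∀ i, u i ∈ Set.Icc (0 : ℝ) 1) (S : Fin K → Fin L) :
    |expectedReward u S - expectedReward w S| ≤
      ∑ k, reachProb w S k * |u (S k) - w (S k)| := by
  have key := Finset.prod_add_ordered Finset.univ (fun k => 1 - u (S k))
    (fun k => u (S k) - w (S k))
  have hsub : ∀ k, (1 - u (S k)) + (u (S k) - w (S k)) = 1 - w (S k) := fun k => by ring
  simp only [hsub] at key
  have : expectedReward u S - expectedReward w S = ∑ k, (u (S k) - w (S k)) *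
      (∏ j with j < k, (1 - w (S j))) * ∏ j with k < j, (1 - u (S j)) := by
    unfold expectedReward; rw [key]; ring
  rw [this]
  refine (Finset.abs_sum_le_sum_abs _ _).trans (Finset.sum_le_sum fun k _ => ?_)
  have h1 : 0 ≤ ∏ j with k < j, (1 - u (S j)) :=
    Finset.prod_nonneg fun _ _ => sub_nonneg.2 (hu _).2
  have h2 : ∏ j with k < j, (1 - u (S j)) ≤ 1 :=
    Finset.prod_le_one (fun _ _ => sub_nonneg.2 (hu _).2) fun j _ => by linarith [(hu (S j)).1]
  have h3 := reachProb_nonneg hw S k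
  rw [abs_mul, abs_mul, abs_of_nonneg h1, ← reachProb, abs_of_nonneg h3, mul_comm |_|]
  exact mul_le_of_le_one_right (by positivity) h2

lemma expectedReward_mono {w u : Fin L → ℝ} (hu : ∀ i, u i ≤ 1) (hwu : ∀ i, w i ≤ u i)
    (S : Fin K → Fin L) : expectedReward w S ≤ expectedReward u S :=
  sub_le_sub_left (Finset.prod_le_prod (fun _ _ => sub_nonneg.2 (hu _))
    fun _ _ => sub_le_sub_left (hwu _) 1) 1

lemma expectedReward_nonneg {w : Fin L → ℝ} (hw : ∀ i, w i ∈ Set.Icc (0 : ℝ) 1)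
    (S : Fin K → Fin L) : 0 ≤ expectedReward w S :=
  sub_nonneg.2 (Finset.prod_le_one (fun _ _ => sub_nonneg.2 (hw _).2)
    fun j _ => by linarith [(hw (S j)).1])

lemma expectedReward_le_one {w : Fin L → ℝ} (hw : ∀ i, w i ∈ Set.Icc (0 : ℝ) 1)
    (S : Fin K → Fin L) : expectedReward w S ≤ 1 :=
  sub_le_self 1 (Finset.prod_nonneg fun _ _ => sub_nonneg.2 (hw _).2)

lemma optimalReward_le {w : Fin L → ℝ} {c : ℝ} (hKL : K ≤ L)
    (h : ∀ S : Fin K ↪ Fin L, expectedReward w S ≤ c) : optimalReward K w ≤ c := by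
  have : Nonempty (Fin K ↪ Fin L) := ⟨Fin.castLEEmb hKL⟩
  exact ciSup_le h

/-- If the truncated scores dominate `w`, a greedy list has at least the optimal reward. -/
lemma IsGreedyList.optimalReward_le {θ w : Fin L → ℝ} {S : Fin K → Fin L} (hKL : K ≤ L)
    (h : IsGreedyList θ S) (hw : ∀ i, w i ∈ Set.Icc (0 : ℝ) 1) (hθ : ∀ i, w i ≤ θ i) :
    optimalReward K w ≤ expectedReward (fun i => clip (θ i)) S := by
  refine CascadingBandit.optimalReward_le hKL fun S' =>
    (expectedReward_mono (fun _ => clip_le_one _) (fun i => ?_) S').trans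
      (h.expectedReward_clip_le S'.injective)
  rw [← clip_of_mem (hw i).1 (hw i).2]
  exact clip_mono (hθ i)

/-- Regret of a greedy list, compared with another greedy list for optimistic scores. -/
lemma optimalReward_sub_expectedReward_le {w θ θ' δ : Fin L → ℝ} {S S' : Fin K → Fin L}
    (hKL : K ≤ L) (hw : ∀ i, w i ∈ Set.Icc (0 : ℝ) 1) (h : IsGreedyList θ S)
    (h' : IsGreedyList θ' S') (hopt : ∀ i, w i ≤ θ' i) (hθ : ∀ i, |θ i - w i| ≤ δ i)
    (hθ' : ∀ i, |θ' i - w i| ≤ δ i) :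
    optimalReward K w - expectedReward w S ≤
      (∑ k, reachProb w S k * δ (S k)) + 2 * ∑ k, reachProb w S' k * δ (S' k) := by
  have bound : ∀ (θ : Fin L → ℝ) (S : Fin K → Fin L), (∀ i, |θ i - w i| ≤ δ i) →
      |expectedReward (fun i => clip (θ i)) S - expectedReward w S| ≤
        ∑ k, reachProb w S k * δ (S k) := fun θ S hθ =>
    (abs_expectedReward_sub_le hw (fun i => ⟨clip_nonneg _, clip_le_one _⟩) S).trans
      (Finset.sum_le_sum fun k _ => mul_le_mul_of_nonneg_left
        ((abs_clip_sub_le (hw _).1 (hw _).2).trans (hθ _)) (reachProb_nonneg hw S k))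
  -- The chain is: optimum ≤ `S'` under `θ'` ≈ `S'` under `w` ≈ `S'` under `θ` ≤ `S` under `θ` ≈ `S`
  -- under `w`. Two of the three approximations concern `S'`.
  have h1 := (abs_le.1 (bound θ S hθ)).2
  have h2 := (abs_le.1 (bound θ S' hθ)).1
  have h3 := (abs_le.1 (bound θ' S' hθ')).2
  have h4 := h.expectedReward_clip_le h'.injective
  have h5 := h'.optimalReward_le hKL hw hopt
  linarith

/-! ### Statistics -/

lemma Stats.empVar_le (s : Stats L) (i : Fin L) : s.empVar i ≤ 1 / 4 := by
  unfold Stats.empVar; nlinarith [sq_nonneg (s.mean i - 1 / 2)]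

lemma log_add_one_nonneg (t : ℕ) : 0 ≤ Real.log ((t : ℝ) + 1) :=
  Real.log_nonneg (by linarith [Nat.cast_nonneg (α := ℝ) t])

lemma Stats.stdDev_nonneg (s : Stats L) (t : ℕ) (i : Fin L) : 0 ≤ s.stdDev t i :=
  le_max_of_le_left (Real.sqrt_nonneg _)

lemma Stats.stdDev_le (s : Stats L) (t : ℕ) (i : Fin L) :
    s.stdDev t i ≤ Real.sqrt (Real.log ((t : ℝ) + 1)) * (1 / Real.sqrt ((s.count i : ℝ) + 1)) +
      Real.log ((t : ℝ) + 1) * (1 / ((s.count i : ℝ) + 1)) := by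
  have hl := log_add_one_nonneg t
  have h0 : 0 ≤ Real.log ((t : ℝ) + 1) / ((s.count i : ℝ) + 1) := by positivity
  have h1 : Real.sqrt (s.empVar i * Real.log ((t : ℝ) + 1) / ((s.count i : ℝ) + 1)) ≤
      Real.sqrt (Real.log ((t : ℝ) + 1)) * (1 / Real.sqrt ((s.count i : ℝ) + 1)) := by
    rw [mul_one_div, ← Real.sqrt_div hl]
    refine Real.sqrt_le_sqrt ?_
    gcongr
    nlinarith [s.empVar_le i]
  have h2 : 0 ≤ Real.sqrt (Real.log ((t : ℝ) + 1)) * (1 / Real.sqrt ((s.count i : ℝ) + 1)) := by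
    positivity
  rw [mul_one_div] at *
  unfold Stats.stdDev
  rw [mul_one_div]
  exact max_le (by linarith) (by linarith)

lemma stats_mean_mem (S : ℕ → Fin K → Fin L) (W : ℕ → Fin L → Bool) (t : ℕ) (i : Fin L) :
    (stats S W t).mean i ∈ Set.Icc (0 : ℝ) 1 := by
  induction t using stats.induct with
  | case1 => simp [stats, Stats.init]
  | case2 => simp [stats, Stats.init]
  | case3 t ih =>
    simp only [stats, Stats.update]
    split_ifs with h1 h2
    · refine ⟨by have := ih.1; positivity, (div_le_one (by positivity)).2 ?_⟩
      nlinarith [ih.2, Nat.cast_nonneg (α := ℝ) ((stats S W (t + 1)).count i)]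
    · refine ⟨by have := ih.1; positivity, (div_le_one (by positivity)).2 ?_⟩
      nlinarith [ih.2, Nat.cast_nonneg (α := ℝ) ((stats S W (t + 1)).count i)]
    · exact ih

lemma stats_count_le (S : ℕ → Fin K → Fin L) (W : ℕ → Fin L → Bool) (t : ℕ) (i : Fin L) :
    (stats S W (t + 1)).count i ≤ t := by
  induction t with
  | zero => simp [stats, Stats.init]
  | succ t ih => simp only [stats, Stats.update]; split_ifs <;> omega

-- At the rounds in which `i` is observed, its count runs through `0, 1, 2, …`, each value once.
open Classical in
lemma sum_observed_eq_sum_range (S : ℕ → Fin K → Fin L) (W : ℕ → Fin L → Bool) (i : Fin L)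
    (g : ℕ → ℝ) (T : ℕ) :
    ∑ t ∈ Finset.Icc 1 T,
        (if Observed (S t) (W t) i then g ((stats S W t).count i) else 0) =
      ∑ n ∈ Finset.range ((stats S W (T + 1)).count i), g n := by
  induction T with
  | zero => simp [stats, Stats.init]
  | succ T ih =>
    rw [Finset.sum_Icc_succ_top (by omega), ih]
    simp only [stats, Stats.update]
    split_ifs with h
    · rw [Finset.sum_range_succ]
    · simp

open Classical in
lemma sum_count_le (S : ℕ → Fin K → Fin L) (W : ℕ → Fin L → Bool) (T : ℕ) :
    ∑ i, (stats S W (T + 1)).count i ≤ K * T := by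
  induction T with
  | zero => simp [stats, Stats.init]
  | succ T ih =>
    have h1 : ∀ i, (stats S W (T + 1 + 1)).count i = (stats S W (T + 1)).count i +
        if Observed (S (T + 1)) (W (T + 1)) i then 1 else 0 := fun i => by
      simp only [stats, Stats.update]; split_ifs <;> rfl
    simp only [h1, Finset.sum_add_distrib, Finset.sum_boole, Nat.cast_id]
    have h2 : (Finset.univ.filter fun i => Observed (S (T + 1)) (W (T + 1)) i).card ≤ K := by
      calc _ ≤ (Finset.univ.image (S (T + 1))).card := by
            refine Finset.card_le_card fun i hi => ?_
            obtain ⟨k, hk, -⟩ := (Finset.mem_filter.1 hi).2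
            exact Finset.mem_image.2 ⟨k, Finset.mem_univ _, hk⟩
        _ ≤ _ := Finset.card_image_le.trans (by simp)
    rw [mul_add]; omega

lemma sum_range_inv_sqrt_le (n : ℕ) :
    ∑ m ∈ Finset.range n, 1 / Real.sqrt ((m : ℝ) + 1) ≤ 2 * Real.sqrt n := by
  induction n with
  | zero => simp
  | succ n ih =>
    rw [Finset.sum_range_succ]
    push_cast
    have h0 : (0 : ℝ) ≤ n := Nat.cast_nonneg n
    have ha := Real.sq_sqrt h0
    have hb := Real.sq_sqrt (show (0 : ℝ) ≤ n + 1 by positivity)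
    have hb0 : 0 < Real.sqrt ((n : ℝ) + 1) := Real.sqrt_pos.2 (by positivity)
    have : 1 / Real.sqrt ((n : ℝ) + 1) ≤ 2 * Real.sqrt (n + 1) - 2 * Real.sqrt n := by
      rw [div_le_iff₀ hb0]
      nlinarith [sq_nonneg (Real.sqrt ((n : ℝ) + 1) - Real.sqrt n)]
    linarith

lemma sum_range_inv_le {n T : ℕ} (hn : n ≤ T) :
    ∑ m ∈ Finset.range n, 1 / ((m : ℝ) + 1) ≤ 1 + Real.log T := by
  calc _ ≤ ∑ m ∈ Finset.range T, 1 / ((m : ℝ) + 1) :=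
        Finset.sum_le_sum_of_subset_of_nonneg (by simpa using hn) fun _ _ _ => by positivity
    _ = (harmonic T : ℝ) := by simp [harmonic]
    _ ≤ _ := harmonic_le_one_add_log T

open Classical in
/-- Pathwise bound on the accumulated standard deviations of the observed items. -/
lemma sum_observed_stdDev_le (S : ℕ → Fin K → Fin L) (W : ℕ → Fin L → Bool) (T : ℕ) :
    ∑ t ∈ Finset.Icc 1 T, ∑ i,
        (if Observed (S t) (W t) i then
          Real.sqrt (Real.log ((t : ℝ) + 1)) * (stats S W t).stdDev t i else 0) ≤
      Real.log ((T : ℝ) + 1) * (2 * Real.sqrt ((K : ℝ) * L * T)) +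
        Real.sqrt (Real.log ((T : ℝ) + 1)) * Real.log ((T : ℝ) + 1) * (L * (1 + Real.log T)) := by
  set ℓ := Real.log ((T : ℝ) + 1)
  have hℓ : 0 ≤ ℓ := log_add_one_nonneg T
  have step : ∀ i, ∑ t ∈ Finset.Icc 1 T, (if Observed (S t) (W t) i then
          Real.sqrt (Real.log ((t : ℝ) + 1)) * (stats S W t).stdDev t i else 0) ≤
      ℓ * (2 * Real.sqrt ((stats S W (T + 1)).count i)) + Real.sqrt ℓ * ℓ * (1 + Real.log T) := by
    intro i
    -- Replacing the logarithms of round `t` by `ℓ` leaves a summand that depends on `t` only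
    -- through the count.
    calc _ ≤ ∑ t ∈ Finset.Icc 1 T, (if Observed (S t) (W t) i then
            (fun n : ℕ => ℓ * (1 / Real.sqrt ((n : ℝ) + 1)) + Real.sqrt ℓ * ℓ * (1 / ((n : ℝ) + 1)))
              ((stats S W t).count i) else 0) := by
          refine Finset.sum_le_sum fun t ht => ?_
          split_ifs
          · have htℓ : Real.log ((t : ℝ) + 1) ≤ ℓ := by
              refine Real.log_le_log (by positivity) ?_
              have : (t : ℝ) ≤ T := by exact_mod_cast (Finset.mem_Icc.1 ht).2
              linarith
            have ht0 := log_add_one_nonneg t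
            calc _ ≤ Real.sqrt ℓ * (Real.sqrt ℓ * (1 / Real.sqrt (((stats S W t).count i : ℝ) + 1)) +
                  ℓ * (1 / (((stats S W t).count i : ℝ) + 1))) := by
                  refine mul_le_mul (Real.sqrt_le_sqrt htℓ)
                    (((stats S W t).stdDev_le t i).trans ?_) (Stats.stdDev_nonneg _ _ _)
                    (Real.sqrt_nonneg _)
                  gcongr
              _ = _ := by
                  rw [mul_add, ← mul_assoc, Real.mul_self_sqrt hℓ]; ring
          · exact le_rfl
      _ ≤ _ := by
          rw [sum_observed_eq_sum_range S W i (fun n : ℕ =>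
            ℓ * (1 / Real.sqrt ((n : ℝ) + 1)) + Real.sqrt ℓ * ℓ * (1 / ((n : ℝ) + 1))), Finset.sum_add_distrib, ← Finset.mul_sum, ← Finset.mul_sum]
          gcongr
          · exact sum_range_inv_sqrt_le _
          · exact sum_range_inv_le (stats_count_le S W T i)
  rw [Finset.sum_comm]
  refine (Finset.sum_le_sum fun i _ => step i).trans ?_
  rw [Finset.sum_add_distrib, ← Finset.mul_sum, ← Finset.mul_sum, Finset.sum_const,
    Finset.card_univ, Fintype.card_fin, nsmul_eq_mul]
  have hcs : ∑ i, Real.sqrt ((stats S W (T + 1)).count i) ≤ Real.sqrt ((K : ℝ) * L * T) := by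
    refine Real.le_sqrt_of_sq_le ?_
    have h1 := sq_sum_le_card_mul_sum_sq (s := (Finset.univ : Finset (Fin L)))
      (f := fun i => Real.sqrt ((stats S W (T + 1)).count i))
    simp only [Real.sq_sqrt (Nat.cast_nonneg (α := ℝ) _), Finset.card_univ, Fintype.card_fin] at h1
    have h2 : (∑ i, ((stats S W (T + 1)).count i : ℝ)) ≤ K * T := by
      exact_mod_cast sum_count_le S W T
    calc _ ≤ _ := h1
      _ ≤ L * ((K : ℝ) * T) := by gcongr
      _ = _ := by ring
  have : ℓ * (2 * ∑ i, Real.sqrt ((stats S W (T + 1)).count i)) ≤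
      ℓ * (2 * Real.sqrt ((K : ℝ) * L * T)) := by gcongr
  linarith

/-! ### Empirical Bernstein bound -/

/-- In `exp y ≤ 1 + y + y²` the linear terms average to zero and the quadratic ones to `x²` times
the variance. -/
lemma bernoulli_mgf_le {p x : ℝ} (hp : p ∈ Set.Icc (0 : ℝ) 1) (hx : |x| ≤ 1) :
    p * Real.exp (x * (1 - p)) + (1 - p) * Real.exp (x * (0 - p)) ≤
      Real.exp (x ^ 2 * (p * (1 - p))) := by
  obtain ⟨h0, h1⟩ := hp
  have quad : ∀ y : ℝ, |y| ≤ 1 → Real.exp y ≤ 1 + y + y ^ 2 := fun y hy => by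
    have := (abs_le.1 (Real.abs_exp_sub_one_sub_id_le hy)).2
    linarith
  have e1 := quad (x * (1 - p)) (by
    rw [abs_mul]; exact mul_le_one₀ hx (abs_nonneg _) (abs_le.2 ⟨by linarith, by linarith⟩))
  have e2 := quad (x * (0 - p)) (by
    rw [abs_mul]; exact mul_le_one₀ hx (abs_nonneg _) (abs_le.2 ⟨by linarith, by linarith⟩))
  have e3 := Real.add_one_le_exp (x ^ 2 * (p * (1 - p)))
  have h1' : 0 ≤ 1 - p := by linarith
  nlinarith [mul_le_mul_of_nonneg_left e1 h0, mul_le_mul_of_nonneg_left e2 h1']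

/-- The optimal parameter in Bernstein's inequality with variance `V` and level `x`. -/
noncomputable def bernsteinParam (V x : ℝ) : ℝ := if x ≤ V then Real.sqrt (x / V) else 1

lemma bernsteinParam_nonneg (V x : ℝ) : 0 ≤ bernsteinParam V x := by
  unfold bernsteinParam; split_ifs <;> positivity

lemma bernsteinParam_le_one {V x : ℝ} (hx : 0 < x) : bernsteinParam V x ≤ 1 := by
  unfold bernsteinParam
  split_ifs with h
  · exact Real.sqrt_le_one.2 ((div_le_one (by linarith)).2 h)
  · exact le_rfl

/-- If `x ≤ V`, the parameter makes the quadratic term equal to `x`; otherwise it is `1` and `V <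
x`. -/
lemma le_of_bernsteinParam {V x D : ℝ} (hx : 0 < x)
    (h : bernsteinParam V x * D - bernsteinParam V x ^ 2 * V < x) :
    D ≤ 2 * Real.sqrt (x * V) + 2 * x := by
  unfold bernsteinParam at h
  have hs := Real.sqrt_nonneg (x * V)
  split_ifs at h with hxV
  · have hV' : 0 < V := by linarith
    rw [Real.sq_sqrt (by positivity), div_mul_cancel₀ _ hV'.ne'] at h
    have h1 : Real.sqrt (x / V) * D < 2 * x := by linarith
    have h2 : Real.sqrt (x / V) * Real.sqrt (x * V) = x := by
      rw [← Real.sqrt_mul (by positivity), show x / V * (x * V) = x * x by field_simp,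
        Real.sqrt_mul_self hx.le]
    have h3 : 0 < Real.sqrt (x / V) := Real.sqrt_pos.2 (by positivity)
    by_contra! hD
    nlinarith
  · nlinarith

/-- Bernstein's inequality with the variance replaced by the empirical variance. -/
lemma empirical_bernstein {a w n x : ℝ} (ha : a ∈ Set.Icc (0 : ℝ) 1) (hw : w ∈ Set.Icc (0 : ℝ) 1)
    (hn : 1 ≤ n) (hx : 0 ≤ x)
    (h : n * |a - w| ≤ 2 * Real.sqrt (3 * x * (n * (w * (1 - w)))) + 2 * (3 * x)) :
    |a - w| ≤ 64 * max (Real.sqrt (a * (1 - a) * x / (n + 1))) (x / (n + 1)) := by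
  obtain ⟨a0, a1⟩ := ha
  obtain ⟨w0, w1⟩ := hw
  set d := |a - w| with hd
  have hd0 : 0 ≤ d := abs_nonneg _
  have hn0 : 0 < n := by linarith
  set m := max (Real.sqrt (a * (1 - a) * x / (n + 1))) (x / (n + 1)) with hm
  have hm1 : x ≤ m * (n + 1) := (div_le_iff₀ (by linarith)).1 (le_max_right _ _)
  have hm0 : 0 ≤ m := le_max_of_le_left (Real.sqrt_nonneg _)
  have ha' : 0 ≤ a * (1 - a) := mul_nonneg a0 (by linarith)
  have hm2 : a * (1 - a) * x ≤ m ^ 2 * (n + 1) := by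
    have h1 : a * (1 - a) * x / (n + 1) ≤ m ^ 2 := by
      rw [← Real.sq_sqrt (show 0 ≤ a * (1 - a) * x / (n + 1) by positivity)]
      exact pow_le_pow_left₀ (Real.sqrt_nonneg _) (le_max_left _ _) 2
    exact (div_le_iff₀ (by linarith)).1 h1
  -- The variance is a 1-Lipschitz function of the mean, so the exchange costs at most the error `d`
  -- being bounded.
  have hvar : w * (1 - w) ≤ a * (1 - a) + d := by
    have : w * (1 - w) - a * (1 - a) = (w - a) * (1 - w - a) := by ring
    have h2 : |(w - a) * (1 - w - a)| ≤ d := by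
      rw [abs_mul, abs_sub_comm w a]
      exact mul_le_of_le_one_right (abs_nonneg _) (abs_le.2 ⟨by linarith, by linarith⟩)
    linarith [le_abs_self ((w - a) * (1 - w - a))]
  -- If `d > 64 m`, then `x ≤ n d / 32`, and the right side of `h` is at most `(0.62 + 6/32) n d < n
  -- d`.
  by_contra! hlt
  have hdm : m < d / 64 := by linarith
  have hxd : x ≤ d / 64 * (2 * n) := hm1.trans (by nlinarith)
  have hrad : 3 * x * (n * (w * (1 - w))) ≤ (31 / 100 * (n * d)) ^ 2 := by
    have k1 : a * (1 - a) * x ≤ (d / 64) ^ 2 * (2 * n) := hm2.trans (by gcongr; linarith)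
    have k2 : w * (1 - w) * x ≤ (d / 64) ^ 2 * (2 * n) + d * (d / 64 * (2 * n)) := by
      nlinarith [mul_le_mul_of_nonneg_right hvar hx, mul_le_mul_of_nonneg_left hxd hd0]
    calc 3 * x * (n * (w * (1 - w))) = 3 * n * (w * (1 - w) * x) := by ring
      _ ≤ 3 * n * ((d / 64) ^ 2 * (2 * n) + d * (d / 64 * (2 * n))) := by gcongr
      _ ≤ _ := by nlinarith [sq_nonneg (n * d)]
  have hs : Real.sqrt (3 * x * (n * (w * (1 - w)))) ≤ 31 / 100 * (n * d) :=
    Real.sqrt_le_iff.2 ⟨by positivity, hrad⟩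
  have hpos : 0 < n * d := mul_pos hn0 (by linarith)
  nlinarith

/-! ### Random variables with finitely many values -/

section FiniteValued

variable {Ω α β : Type*}

/-- `X` takes finitely many values and all of its events belong to the σ-algebra `m`. -/
structure FiniteValued (m : MeasurableSpace Ω) (X : Ω → α) : Prop where
  finite_range : (Set.range X).Finite
  measurableSet : ∀ A : Set α, MeasurableSet[m] (X ⁻¹' A)

lemma FiniteValued.mono {m m' : MeasurableSpace Ω} {X : Ω → α} (h : FiniteValued m X)
    (hm : m ≤ m') : FiniteValued m' X :=
  ⟨h.1, fun A => hm _ (h.2 A)⟩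

/-- No measurability of `f` is needed. Thus arbitrary functions of `Stats`, a type without
σ-algebra, can be integrated. -/
lemma FiniteValued.comp {m : MeasurableSpace Ω} {X : Ω → α} (h : FiniteValued m X) (f : α → β) :
    FiniteValued m fun ω => f (X ω) :=
  ⟨(h.1.image f).subset (by rintro _ ⟨ω, rfl⟩; exact ⟨_, ⟨ω, rfl⟩, rfl⟩), fun A => h.2 (f ⁻¹' A)⟩

lemma FiniteValued.prodMk {m : MeasurableSpace Ω} {X : Ω → α} {Y : Ω → β} (hX : FiniteValued m X)
    (hY : FiniteValued m Y) : FiniteValued m fun ω => (X ω, Y ω) := by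
  refine ⟨(hX.1.prod hY.1).subset (by rintro _ ⟨ω, rfl⟩; exact ⟨⟨ω, rfl⟩, ⟨ω, rfl⟩⟩), fun A => ?_⟩
  have : (fun ω => (X ω, Y ω)) ⁻¹' A =
      ⋃ x ∈ Set.range X, X ⁻¹' {x} ∩ Y ⁻¹' {y | (x, y) ∈ A} := by
    ext ω
    simp only [Set.mem_preimage, Set.mem_iUnion, Set.mem_inter_iff, Set.mem_singleton_iff,
      Set.mem_ofPred_eq]
    exact ⟨fun h => ⟨X ω, ⟨ω, rfl⟩, rfl, h⟩, fun ⟨x, _, h1, h2⟩ => h1 ▸ h2⟩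
  rw [this]
  exact hX.1.measurableSet_biUnion fun x _ => (hX.2 _).inter (hY.2 _)

lemma FiniteValued.of_comap [Finite α] [MeasurableSpace α] [DiscreteMeasurableSpace α] (X : Ω → α) :
    FiniteValued (MeasurableSpace.comap X inferInstance) X :=
  ⟨Set.toFinite _, fun A => ⟨A, .of_discrete, rfl⟩⟩

lemma FiniteValued.measurable {m : MeasurableSpace Ω} [MeasurableSpace α] {X : Ω → α}
    (h : FiniteValued m X) : Measurable[m] X :=
  fun A _ => h.2 A

lemma FiniteValued.integrable {m : MeasurableSpace Ω} {μ : Measure Ω} [IsFiniteMeasure μ]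
    {X : Ω → ℝ} (h : FiniteValued m X) : Integrable X μ := by
  let f : SimpleFunc Ω ℝ := ⟨X, fun x => h.2 {x}, h.1⟩
  exact f.integrable_of_isFiniteMeasure

end FiniteValued

/-! ### Runs of the algorithm -/

/-- The confidence event: every empirical mean is accurate up to `64` standard deviations. -/
def Accurate (w : Fin L → ℝ) (t : ℕ) (s : Stats L) : Prop :=
  ∀ i, |s.mean i - w i| ≤ 64 * s.stdDev t i

section Run

variable {Ω : Type*} [MeasurableSpace Ω] {μ : Measure Ω} {w : Fin L → ℝ} {Z : ℕ → Ω → ℝ}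
  {S : ℕ → Ω → Fin K → Fin L} {W : ℕ → Ω → Fin L → Bool}

/-- The statistics at the start of round `t` as a random variable. -/
noncomputable abbrev runStats (S : ℕ → Ω → Fin K → Fin L) (W : ℕ → Ω → Fin L → Bool) (t : ℕ)
    (ω : Ω) : Stats L :=
  stats (fun s => S s ω) (fun s => W s ω) t

omit [MeasurableSpace Ω] in
lemma past_le_past_succ (t : ℕ) : past Z S W t ≤ past Z S W (t + 1) :=
  biSup_mono fun _ hs => Finset.Ico_subset_Ico_right (Nat.le_succ t) hs

omit [MeasurableSpace Ω] in
lemma finiteValued_runStats (t : ℕ) : FiniteValued (past Z S W t) (runStats S W t) := by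
  induction t using stats.induct with
  | case1 => exact ⟨(Set.finite_singleton (Stats.init L)).subset (by rintro _ ⟨ω, rfl⟩; rfl),
      fun A => .const (Stats.init L ∈ A)⟩
  | case2 => exact ⟨(Set.finite_singleton (Stats.init L)).subset (by rintro _ ⟨ω, rfl⟩; rfl),
      fun A => .const (Stats.init L ∈ A)⟩
  | case3 t ih =>
    have hle : (MeasurableSpace.comap (Z (t + 1)) inferInstance ⊔
        MeasurableSpace.comap (S (t + 1)) inferInstance ⊔
          MeasurableSpace.comap (W (t + 1)) inferInstance) ≤ past Z S W (t + 2) :=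
      le_biSup (fun s => MeasurableSpace.comap (Z s) inferInstance ⊔
        MeasurableSpace.comap (S s) inferInstance ⊔ MeasurableSpace.comap (W s) inferInstance)
        (Finset.mem_Ico.2 ⟨by omega, by omega⟩)
    have hS : FiniteValued (past Z S W (t + 2)) (S (t + 1)) :=
      (FiniteValued.of_comap _).mono ((le_sup_right.trans le_sup_left).trans hle)
    have hW : FiniteValued (past Z S W (t + 2)) (W (t + 1)) :=
      (FiniteValued.of_comap _).mono (le_sup_right.trans hle)
    exact ((ih.mono (past_le_past_succ _)).prodMk (hS.prodMk hW)).comp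
      fun p => p.1.update p.2.1 p.2.2

namespace IsTSCascade

variable (h : IsTSCascade μ w Z S W)
include h

lemma past_le (t : ℕ) : past Z S W t ≤ ‹MeasurableSpace Ω› :=
  iSup₂_le fun s hs => by
    have hs1 := (Finset.mem_Ico.1 hs).1
    exact sup_le (sup_le (h.measurable_seed s hs1).comap_le (h.measurable_list s hs1).comap_le)
      (h.measurable_click s hs1).comap_le

lemma finiteValued_stats (t : ℕ) : FiniteValued ‹MeasurableSpace Ω› (runStats S W t) :=
  (finiteValued_runStats t).mono (h.past_le t)

lemma finiteValued_list {t : ℕ} (ht : 1 ≤ t) : FiniteValued ‹MeasurableSpace Ω› (S t) :=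
  (FiniteValued.of_comap _).mono (h.measurable_list t ht).comap_le

lemma finiteValued_click {t : ℕ} (ht : 1 ≤ t) : FiniteValued ‹MeasurableSpace Ω› (W t) :=
  (FiniteValued.of_comap _).mono (h.measurable_click t ht).comap_le

variable [IsProbabilityMeasure μ]

lemma integrable_round {t : ℕ} (ht : 1 ≤ t)
    (φ : Stats L → (Fin K → Fin L) → (Fin L → Bool) → ℝ) :
    Integrable (fun ω => φ (runStats S W t ω) (S t ω) (W t ω)) μ :=
  (((h.finiteValued_stats t).prodMk ((h.finiteValued_list ht).prodMk
    (h.finiteValued_click ht))).comp fun p => φ p.1 p.2.1 p.2.2).integrable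

lemma integrable_list {t : ℕ} (ht : 1 ≤ t) (φ : Stats L → (Fin K → Fin L) → ℝ) :
    Integrable (fun ω => φ (runStats S W t ω) (S t ω)) μ :=
  h.integrable_round ht fun s a _ => φ s a

/-- The clicks of a round may be averaged given the statistics and the list. -/
lemma integral_mul_click {t : ℕ} (ht : 1 ≤ t) (φ : Stats L → (Fin K → Fin L) → ℝ)
    (ψ : (Fin K → Fin L) → (Fin L → Bool) → ℝ) :
    ∫ ω, φ (runStats S W t ω) (S t ω) * ψ (S t ω) (W t ω) ∂μ =
      ∫ ω, φ (runStats S W t ω) (S t ω) * (∫ ω', ψ (S t ω) (W t ω') ∂μ) ∂μ := by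
  classical
  -- Splitting by the value `a` of the list makes the click factor a function of `W t` alone,
  -- independent of `X a`.
  set X : (Fin K → Fin L) → Ω → ℝ := fun a ω => if S t ω = a then φ (runStats S W t ω) a else 0
  have hXm : ∀ a, FiniteValued (past Z S W t ⊔ MeasurableSpace.comap (Z t) inferInstance ⊔
      MeasurableSpace.comap (S t) inferInstance) (X a) := fun a =>
    (((finiteValued_runStats t).mono (le_sup_left.trans le_sup_left)).prodMk
      ((FiniteValued.of_comap (S t)).mono le_sup_right)).comp
        fun p => if p.2 = a then φ p.1 a else 0
  have hXi : ∀ a, Integrable (X a) μ := fun a =>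
    h.integrable_list ht fun s b => if b = a then φ s a else 0
  have hWi : ∀ a, Integrable (fun ω => ψ a (W t ω)) μ := fun a =>
    h.integrable_round ht fun _ _ b => ψ a b
  have hind : ∀ a, IndepFun (X a) (fun ω => ψ a (W t ω)) μ := fun a => by
    rw [IndepFun_iff_Indep]
    refine indep_of_indep_of_le_left (indep_of_indep_of_le_right (h.click_indep t ht) ?_) ?_
    · exact (((FiniteValued.of_comap (W t)).comp (ψ a)).measurable).comap_le
    · exact (hXm a).measurable.comap_le
  have e1 : ∀ ω, φ (runStats S W t ω) (S t ω) * ψ (S t ω) (W t ω) =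
      ∑ a, X a ω * ψ a (W t ω) := fun ω => by simp [X]
  have e2 : ∀ ω, φ (runStats S W t ω) (S t ω) * (∫ ω', ψ (S t ω) (W t ω') ∂μ) =
      ∑ a, X a ω * ∫ ω', ψ a (W t ω') ∂μ := fun ω => by simp [X]
  simp only [e1, e2]
  rw [integral_finsetSum _ fun a _ => show Integrable (fun ω => X a ω * ψ a (W t ω)) μ from
      (hind a).integrable_mul (hXi a) (hWi a),
    integral_finsetSum _ fun a _ => (hXi a).mul_const _]
  refine Finset.sum_congr rfl fun a _ => ?_
  rw [integral_mul_const, (hind a).integral_fun_mul_eq_mul_integral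
    (hXi a).aestronglyMeasurable (hWi a).aestronglyMeasurable]

lemma integral_click {t : ℕ} (ht : 1 ≤ t) (hw : ∀ i, w i ∈ Set.Icc (0 : ℝ) 1) (i : Fin L)
    (g : Bool → ℝ) : ∫ ω, g (W t ω i) ∂μ = w i * g true + (1 - w i) * g false := by
  have hm : MeasurableSet {ω | W t ω i = true} :=
    (h.finiteValued_click ht).2 {b | b i = true}
  have e : (fun ω => g (W t ω i)) =
      fun ω => g false + {ω | W t ω i = true}.indicator (fun _ => g true - g false) ω := by
    ext ω
    by_cases hω : W t ω i = true
    · simp [Set.indicator, hω]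
    · simp [Set.indicator, hω]
  have hr : μ.real {ω | W t ω i = true} = w i := by
    rw [measureReal_def, h.click_law t ht i, ENNReal.toReal_ofReal (hw i).1]
  rw [e, integral_add (integrable_const _) ((integrable_const _).indicator hm),
    integral_indicator_const _ hm, hr]
  simp only [integral_const, probReal_univ, smul_eq_mul]
  ring

/-- The item at position `k` is observed exactly when no earlier item is clicked. As the items are
distinct, the integrand is a product over independent clicks. -/
lemma integral_observed_mul {t : ℕ} (ht : 1 ≤ t) (hw : ∀ i, w i ∈ Set.Icc (0 : ℝ) 1)
    {a : Fin K → Fin L} (ha : Function.Injective a) (k : Fin K) (g : Bool → ℝ) :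
    ∫ ω, (open Classical in if Observed a (W t ω) (a k) then g (W t ω (a k)) else 0) ∂μ =
      reachProb w a k * (w (a k) * g true + (1 - w (a k)) * g false) := by
  classical
  set J : Finset (Fin L) := (Finset.univ.filter (· < k)).image a with hJ
  have hkJ : a k ∉ J := by
    simp only [hJ, Finset.mem_image, Finset.mem_filter, Finset.mem_univ, true_and, not_exists,
      not_and]
    exact fun j hj hjk => hj.ne (ha hjk)
  set f : Fin L → Bool → ℝ := fun i b =>
    if i ∈ J then (if b = true then 0 else 1) else if i = a k then g b else 1 with hf
  have hobs : ∀ ω, Observed a (W t ω) (a k) ↔ ∀ i ∈ J, W t ω i = false := fun ω => by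
    unfold Observed clickPosition
    have : (∃ k', a k' = a k ∧ (k' : WithTop (Fin K)) ≤
        (Finset.univ.filter fun k => W t ω (a k) = true).min) ↔
        (k : WithTop (Fin K)) ≤ (Finset.univ.filter fun k => W t ω (a k) = true).min :=
      ⟨fun ⟨k', h1, h2⟩ => ha h1 ▸ h2, fun h2 => ⟨k, rfl, h2⟩⟩
    rw [this, Finset.le_min_iff]
    simp only [hJ, Finset.mem_filter, Finset.mem_univ, true_and, WithTop.coe_le_coe,
      Finset.mem_image, forall_exists_index, and_imp, forall_apply_eq_imp_iff₂]
    refine forall_congr' fun j => ?_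
    rw [← not_lt, ← Bool.not_eq_true]
    tauto
  have split : ∀ F : Fin L → ℝ, (∀ i, i ∉ J → i ≠ a k → F i = 1) →
      ∏ i, F i = (∏ i ∈ J, F i) * F (a k) := fun F hF => by
    rw [mul_comm, ← Finset.prod_insert hkJ]
    symm
    refine Finset.prod_subset (Finset.subset_univ _) fun i _ hi => ?_
    rw [Finset.mem_insert, not_or] at hi
    exact hF i hi.2 hi.1
  have e : ∀ ω, (if Observed a (W t ω) (a k) then g (W t ω (a k)) else 0) =
      ∏ i, f i (W t ω i) := fun ω => by
    rw [split _ fun i h1 h2 => by simp [hf, h1, h2]]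
    have h1 : ∏ i ∈ J, f i (W t ω i) = if Observed a (W t ω) (a k) then 1 else 0 := by
      by_cases ho : Observed a (W t ω) (a k)
      · rw [if_pos ho]
        exact Finset.prod_eq_one fun i hi => by simp [hf, hi, (hobs ω).1 ho i hi]
      · rw [if_neg ho]
        rw [hobs] at ho
        push Not at ho
        obtain ⟨i, hi, hWi⟩ := ho
        exact Finset.prod_eq_zero hi (by simpa [hf, hi] using hWi)
    have h2 : f (a k) (W t ω (a k)) = g (W t ω (a k)) := by simp [hf, hkJ]
    rw [h1, h2]; split_ifs <;> simp
  have hm : ∀ i, Measurable fun ω => W t ω i := fun i =>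
    (measurable_pi_apply i).comp (h.measurable_click t ht)
  simp only [e]
  rw [(h.click_iIndep t ht).integral_fun_prod_comp (fun i => (hm i).aemeasurable)
    (fun i => (measurable_of_countable (f i)).aestronglyMeasurable)]
  simp only [h.integral_click ht hw]
  rw [split _ fun i h1 h2 => by simp [hf, h1, h2]]
  congr 1
  · rw [reachProb, hJ, Finset.prod_image fun _ _ _ _ e => ha e]
    refine Finset.prod_congr rfl fun j hj => ?_
    have : a j ∈ J := Finset.mem_image_of_mem _ hj
    simp [hf, this]
  · simp [hf, hkJ]

/-- In expectation, the weights `reachProb` may be replaced by the observations. -/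
lemma integral_sum_reachProb {t : ℕ} (ht : 1 ≤ t) (hw : ∀ i, w i ∈ Set.Icc (0 : ℝ) 1)
    (b : Stats L → Fin L → ℝ) :
    ∫ ω, ∑ k, reachProb w (S t ω) k * b (runStats S W t ω) (S t ω k) ∂μ =
      ∫ ω, ∑ i, (open Classical in
        if Observed (S t ω) (W t ω) i then b (runStats S W t ω) i else 0) ∂μ := by
  classical
  have hinj : ∀ ω, Function.Injective (S t ω) := fun ω => (h.list_greedy t ht ω).injective
  have e : ∀ ω, (∑ i, if Observed (S t ω) (W t ω) i then b (runStats S W t ω) i else 0) =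
      ∑ k, b (runStats S W t ω) (S t ω k) *
        if Observed (S t ω) (W t ω) (S t ω k) then 1 else 0 := fun ω => by
    rw [← Finset.sum_subset (Finset.subset_univ (Finset.univ.image (S t ω))) fun i _ hi => ?_,
      Finset.sum_image fun _ _ _ _ e => hinj ω e]
    · simp
    · refine if_neg fun ⟨k, hk, _⟩ => hi (Finset.mem_image.2 ⟨k, Finset.mem_univ _, hk⟩)
  simp only [e]
  rw [integral_finsetSum _ fun k _ => h.integrable_list ht fun s a =>
      reachProb w a k * b s (a k),
    integral_finsetSum _ fun k _ => h.integrable_round ht fun s a c =>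
      b s (a k) * if Observed a c (a k) then 1 else 0]
  refine Finset.sum_congr rfl fun k _ => ?_
  rw [h.integral_mul_click ht (fun s a => b s (a k))
    (fun a c => if Observed a c (a k) then 1 else 0)]
  refine integral_congr_ae (.of_forall fun ω => ?_)
  have := h.integral_observed_mul ht hw (hinj ω) k (fun _ => 1)
  simp only at this ⊢
  rw [this]; ring

/-! ### Concentration of the empirical means -/

/-- Exponential supermartingale of the centred click counts of item `i`. -/
lemma integral_exp_le_one (hw : ∀ i, w i ∈ Set.Icc (0 : ℝ) 1) (i : Fin L) {x : ℝ} (hx : |x| ≤ 1)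
    (t : ℕ) :
    ∫ ω, Real.exp (x * ((runStats S W (t + 1) ω).count i * ((runStats S W (t + 1) ω).mean i - w i)) -
      x ^ 2 * ((runStats S W (t + 1) ω).count i * (w i * (1 - w i)))) ∂μ ≤ 1 := by
  classical
  induction t with
  | zero => simp [runStats, stats, Stats.init]
  | succ t ih =>
    -- The new round multiplies the exponential by a factor that is `1` unless `i` is observed; it
    -- remains to see that its mean given the past and the list is at most `1`.
    refine le_trans (le_of_eq ?_) (le_trans (integral_mono (μ := μ)
      (f := fun ω => Real.exp (x * ((runStats S W (t + 1) ω).count i *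
        ((runStats S W (t + 1) ω).mean i - w i)) -
          x ^ 2 * ((runStats S W (t + 1) ω).count i * (w i * (1 - w i)))) *
        ∫ ω', (if Observed (S (t + 1) ω) (W (t + 1) ω') i then
          Real.exp (x * ((if W (t + 1) ω' i = true then 1 else 0) - w i) -
            x ^ 2 * (w i * (1 - w i))) else 1) ∂μ) ?_ ?_ ?_) ih)
    · rw [← h.integral_mul_click (t := t + 1) (by omega)
        (fun s _ => Real.exp (x * (s.count i * (s.mean i - w i)) -
          x ^ 2 * (s.count i * (w i * (1 - w i)))))
        (fun a c => if Observed a c i then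
          Real.exp (x * ((if c i = true then 1 else 0) - w i) - x ^ 2 * (w i * (1 - w i))) else 1)]
      refine integral_congr_ae (.of_forall fun ω => ?_)
      simp only [runStats, stats, Stats.update]
      by_cases ho : Observed (S (t + 1) ω) (W (t + 1) ω) i
      · simp only [ho, if_true]
        rw [← Real.exp_add]
        congr 1
        push_cast
        -- The product of count and mean is the number of clicks, so an observation adds `W - w` to
        -- the centred sum.
        have hn : ((stats (fun s => S s ω) (fun s => W s ω) (t + 1)).count i : ℝ) + 1 ≠ 0 := by
          positivity
        field_simp
        ring
      · simp only [ho, if_false, mul_one]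
    · exact h.integrable_list (by omega) fun s a =>
        Real.exp (x * (s.count i * (s.mean i - w i)) - x ^ 2 * (s.count i * (w i * (1 - w i)))) *
        ∫ ω', (if Observed a (W (t + 1) ω') i then
          Real.exp (x * ((if W (t + 1) ω' i = true then 1 else 0) - w i) -
            x ^ 2 * (w i * (1 - w i))) else 1) ∂μ
    · exact h.integrable_list (t := t + 1) (by omega) fun s a =>
        Real.exp (x * (s.count i * (s.mean i - w i)) - x ^ 2 * (s.count i * (w i * (1 - w i))))
    · intro ω
      refine mul_le_of_le_one_right (Real.exp_pos _).le ?_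
      by_cases hi : ∃ k, S (t + 1) ω k = i
      · obtain ⟨k, hk⟩ := hi
        have hinj := (h.list_greedy (t + 1) (by omega) ω).injective
        set a := S (t + 1) ω with ha
        have key := h.integral_observed_mul (t := t + 1) (by omega) hw hinj k
          (fun b => Real.exp (x * ((if b = true then 1 else 0) - w i) -
            x ^ 2 * (w i * (1 - w i))) - 1)
        have e : ∀ ω', (if Observed a (W (t + 1) ω') i then
            Real.exp (x * ((if W (t + 1) ω' i = true then 1 else 0) - w i) -
              x ^ 2 * (w i * (1 - w i))) else 1) = 1 +
            if Observed a (W (t + 1) ω') (a k) then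
            Real.exp (x * ((if W (t + 1) ω' (a k) = true then 1 else 0) - w i) -
              x ^ 2 * (w i * (1 - w i))) - 1 else 0 := fun ω' => by
          rw [hk]; split_ifs <;> ring
        simp only [e]
        rw [integral_add (integrable_const _) (h.integrable_round (t := t + 1) (by omega)
          fun _ _ c => if Observed a c (a k) then
            Real.exp (x * ((if c (a k) = true then 1 else 0) - w i) -
              x ^ 2 * (w i * (1 - w i))) - 1 else 0), key]
        simp only [integral_const, probReal_univ, smul_eq_mul, mul_one, hk, if_true,
          Bool.false_eq_true, if_false]
        have hb := bernoulli_mgf_le (hw i) hx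
        have hr := reachProb_nonneg hw a k
        have : w i * (Real.exp (x * (1 - w i) - x ^ 2 * (w i * (1 - w i))) - 1) +
            (1 - w i) * (Real.exp (x * (0 - w i) - x ^ 2 * (w i * (1 - w i))) - 1) ≤ 0 := by
          have h1 := mul_le_mul_of_nonneg_right hb (Real.exp_pos (-(x ^ 2 * (w i * (1 - w i))))).le
          rw [← Real.exp_add, add_neg_cancel, Real.exp_zero, add_mul, mul_assoc, mul_assoc,
            ← Real.exp_add, ← Real.exp_add, ← sub_eq_add_neg, ← sub_eq_add_neg] at h1
          linarith
        nlinarith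
      · have e : ∀ ω', ¬ Observed (S (t + 1) ω) (W (t + 1) ω') i :=
          fun ω' ⟨k, hk, _⟩ => hi ⟨k, hk⟩
        simp [e]

/-- The best Bernstein parameter depends on the random count, so a union bound runs over items, both
signs and all `t` possible counts. Each event has probability at most `exp (-3ℓ) = (t + 1)⁻³`. -/
lemma measure_not_accurate_le (hw : ∀ i, w i ∈ Set.Icc (0 : ℝ) 1) {t : ℕ} (ht : 1 ≤ t) :
    μ.real {ω | ¬ Accurate w t (runStats S W t ω)} ≤ 2 * L / ((t : ℝ) + 1) ^ 2 := by
  obtain ⟨r, rfl⟩ : ∃ r, t = r + 1 := ⟨t - 1, by omega⟩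
  set ℓ : ℝ := Real.log (((r + 1 : ℕ) : ℝ) + 1) with hℓ
  have hr0 : (0 : ℝ) ≤ r := Nat.cast_nonneg r
  have hℓ2 : Real.log 2 ≤ ℓ := Real.log_le_log (by norm_num) (by push_cast; linarith)
  have hℓ0 : 0 < ℓ := lt_of_lt_of_le (Real.log_pos (by norm_num)) hℓ2
  set p : Fin L → ℕ → ℝ := fun i n => bernsteinParam (n * (w i * (1 - w i))) (3 * ℓ) with hp
  have hp0 : ∀ i n, 0 ≤ p i n := fun i n => bernsteinParam_nonneg _ _
  have hp1 : ∀ i n, |p i n| ≤ 1 := fun i n => by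
    rw [abs_of_nonneg (hp0 i n)]; exact bernsteinParam_le_one (by positivity)
  set M : Fin L → ℝ → Ω → ℝ := fun i x ω =>
    Real.exp (x * ((runStats S W (r + 1) ω).count i * ((runStats S W (r + 1) ω).mean i - w i)) -
      x ^ 2 * ((runStats S W (r + 1) ω).count i * (w i * (1 - w i)))) with hM
  set B : Fin L → ℝ → Set Ω := fun i x => {ω | Real.exp (3 * ℓ) ≤ M i x ω} with hB
  have hBle : ∀ i x, |x| ≤ 1 → μ.real (B i x) ≤ Real.exp (-(3 * ℓ)) := fun i x hx => by
    have h1 := mul_meas_ge_le_integral_of_nonneg (μ := μ) (f := M i x)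
      (.of_forall fun ω => (Real.exp_pos _).le)
      (h.integrable_list (t := r + 1) (by omega) fun s _ =>
        Real.exp (x * (s.count i * (s.mean i - w i)) - x ^ 2 * (s.count i * (w i * (1 - w i)))))
      (Real.exp (3 * ℓ))
    have h2 := h1.trans (h.integral_exp_le_one hw i hx r)
    rw [Real.exp_neg, ← one_div, le_div_iff₀ (Real.exp_pos _), mul_comm]
    exact h2
  have hsub : {ω | ¬ Accurate w (r + 1) (runStats S W (r + 1) ω)} ⊆
      ⋃ i, ⋃ n ∈ Finset.range (r + 1), (B i (p i n) ∪ B i (-p i n)) := by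
    intro ω hω
    by_contra hcon
    simp only [Set.mem_iUnion, not_exists, Set.mem_union, not_or] at hcon
    refine hω fun i => ?_
    set s := runStats S W (r + 1) ω with hs
    have hmem : s.mean i ∈ Set.Icc (0 : ℝ) 1 := stats_mean_mem _ _ _ _
    have hcl : s.count i ≤ r := stats_count_le (fun s => S s ω) (fun s => W s ω) r i
    -- An unobserved item has standard deviation at least `log 2`, and `64 log 2 ≥ 1`.
    rcases Nat.eq_zero_or_pos (s.count i) with h0 | hpos
    · have h1 : |s.mean i - w i| ≤ 1 :=
        abs_le.2 ⟨by linarith [hmem.1, (hw i).2], by linarith [hmem.2, (hw i).1]⟩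
      have h2 : ℓ ≤ s.stdDev (r + 1) i := by
        refine le_trans ?_ (le_max_right _ _)
        rw [h0]; simp [hℓ]
      have := Real.log_two_gt_d9
      linarith
    · obtain ⟨c1, c2⟩ := hcon i (s.count i) (Finset.mem_range.2 (by omega))
      simp only [hB, hM, Set.mem_ofPred_eq, not_le, Real.exp_lt_exp, ← hs] at c1 c2
      rw [neg_sq, neg_mul, ← mul_neg] at c2
      have d1 := le_of_bernsteinParam (by positivity) c1
      have d2 := le_of_bernsteinParam (by positivity) c2
      have hn : (1 : ℝ) ≤ s.count i := by exact_mod_cast hpos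
      refine empirical_bernstein hmem (hw i) hn hℓ0.le ?_
      rw [← abs_of_nonneg (show (0 : ℝ) ≤ s.count i by linarith), ← abs_mul,
        abs_of_nonneg (show (0 : ℝ) ≤ s.count i by linarith)]
      exact abs_le.2 ⟨by linarith, d1⟩
  have hexp : Real.exp (-(3 * ℓ)) = 1 / (((r + 1 : ℕ) : ℝ) + 1) ^ 3 := by
    rw [Real.exp_neg, show (3 : ℝ) * ℓ = (3 : ℕ) * ℓ by norm_num, Real.exp_nat_mul, hℓ,
      Real.exp_log (by positivity), one_div]
  calc _ ≤ μ.real (⋃ i, ⋃ n ∈ Finset.range (r + 1), (B i (p i n) ∪ B i (-p i n))) :=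
        measureReal_mono hsub
    _ ≤ ∑ i, μ.real (⋃ n ∈ Finset.range (r + 1), (B i (p i n) ∪ B i (-p i n))) :=
        measureReal_iUnion_fintype_le _
    _ ≤ ∑ i : Fin L, ∑ n ∈ Finset.range (r + 1), 2 * Real.exp (-(3 * ℓ)) := by
        refine Finset.sum_le_sum fun i _ => (measureReal_biUnion_finset_le _ _).trans
          (Finset.sum_le_sum fun n _ => (measureReal_union_le _ _).trans ?_)
        linarith [hBle i (p i n) (hp1 i n), hBle i (-p i n) (by rw [abs_neg]; exact hp1 i n)]
    _ = 2 * L * ((r + 1 : ℕ) : ℝ) / (((r + 1 : ℕ) : ℝ) + 1) ^ 3 := by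
        simp only [Finset.sum_const, Finset.card_univ, Fintype.card_fin, Finset.card_range,
          nsmul_eq_mul, hexp]
        ring
    _ ≤ _ := by
        rw [div_le_div_iff₀ (by positivity) (by positivity)]
        have : (0 : ℝ) ≤ 2 * L * (((r + 1 : ℕ) : ℝ) + 1) ^ 2 := by positivity
        nlinarith

end IsTSCascade

end Run

/-! ### Gaussian seeds -/

lemma gaussianReal_tail_le {b : ℝ} (hb : 0 ≤ b) :
    (gaussianReal 0 1).real {x | b < |x|} ≤ 2 * Real.exp (-(b ^ 2 / 2)) := by
  have h1 := measure_ge_le_exp_mul_mgf (μ := gaussianReal 0 1) (X := id) b hb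
    (integrable_exp_mul_gaussianReal b)
  have h2 := measure_le_le_exp_mul_mgf (μ := gaussianReal 0 1) (X := id) (-b)
    (neg_nonpos.2 hb) (integrable_exp_mul_gaussianReal (-b))
  rw [mgf_id_gaussianReal] at h1 h2
  simp only [← Real.exp_add] at h1 h2
  have e1 : -b * b + (0 * b + ((1 : NNReal) : ℝ) * b ^ 2 / 2) = -(b ^ 2 / 2) := by
    push_cast; ring
  have e2 : -(-b) * -b + (0 * -b + ((1 : NNReal) : ℝ) * (-b) ^ 2 / 2) = -(b ^ 2 / 2) := by
    push_cast; ring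
  rw [e1] at h1
  rw [e2] at h2
  calc _ ≤ (gaussianReal 0 1).real ({x | b ≤ id x} ∪ {x | id x ≤ -b}) := by
        refine measureReal_mono fun x hx => ?_
        rcases lt_abs.1 (show b < |x| from hx) with h | h
        · exact Or.inl h.le
        · exact Or.inr (show x ≤ -b by linarith)
    _ ≤ _ := measureReal_union_le _ _
    _ ≤ _ := by linarith

lemma gaussianReal_Icc_pos {a b : ℝ} (hab : a < b) : 0 < (gaussianReal 0 1).real (Set.Icc a b) := by
  refine ENNReal.toReal_pos (fun h0 => ?_) (measure_ne_top _ _)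
  have := gaussianReal_absolutelyContinuous' 0 one_ne_zero h0
  rw [Real.volume_Icc, ENNReal.ofReal_eq_zero] at this
  linarith

/-! ### Regret of one round -/

/-- The width of the confidence interval of the Thompson sample of item `i` around `w i`. -/
noncomputable def width (t : ℕ) (s : Stats L) (i : Fin L) : ℝ :=
  200 * (Real.sqrt (Real.log ((t : ℝ) + 1)) * s.stdDev t i)

/-- The expected total width of the items of the list that are examined. -/
noncomputable def listWidth (w : Fin L → ℝ) (t : ℕ) (s : Stats L) (a : Fin K → Fin L) : ℝ :=
  ∑ k, reachProb w a k * width t s (a k)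

lemma width_nonneg (t : ℕ) (s : Stats L) (i : Fin L) : 0 ≤ width t s i :=
  mul_nonneg (by norm_num) (mul_nonneg (Real.sqrt_nonneg _) (s.stdDev_nonneg t i))

lemma listWidth_nonneg {w : Fin L → ℝ} (hw : ∀ i, w i ∈ Set.Icc (0 : ℝ) 1) (t : ℕ) (s : Stats L)
    (a : Fin K → Fin L) : 0 ≤ listWidth w t s a :=
  Finset.sum_nonneg fun k _ => mul_nonneg (reachProb_nonneg hw a k) (width_nonneg t s _)

lemma sqrt_log_ge {t : ℕ} (ht : 1 ≤ t) : 4 / 5 ≤ Real.sqrt (Real.log ((t : ℝ) + 1)) := by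
  have h1 : (1 : ℝ) ≤ t := by exact_mod_cast ht
  have h2 : Real.log 2 ≤ Real.log ((t : ℝ) + 1) := Real.log_le_log (by norm_num) (by linarith)
  refine Real.le_sqrt_of_sq_le ?_
  linarith [Real.log_two_gt_d9]

lemma Accurate.abs_thompson_sub_le {w : Fin L → ℝ} {t : ℕ} {s : Stats L} (h : Accurate w t s)
    (ht : 1 ≤ t) {z : ℝ} (hz : |z| ≤ 100 * Real.sqrt (Real.log ((t : ℝ) + 1))) (i : Fin L) :
    |s.thompson t z i - w i| ≤ width t s i := by
  have h0 := s.stdDev_nonneg t i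
  have h1 := sqrt_log_ge ht
  calc |s.thompson t z i - w i| = |(s.mean i - w i) + z * s.stdDev t i| := by
        unfold Stats.thompson; congr 1; ring
    _ ≤ |s.mean i - w i| + |z * s.stdDev t i| := abs_add_le _ _
    _ ≤ 64 * s.stdDev t i + 100 * Real.sqrt (Real.log ((t : ℝ) + 1)) * s.stdDev t i := by
        rw [abs_mul, abs_of_nonneg h0]
        exact add_le_add (h i) (mul_le_mul_of_nonneg_right hz h0)
    -- As `√log (t + 1) ≥ 4/5`, one has `64 ≤ 80 √log (t + 1)`, so `180` in place of `200` would do.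
    _ ≤ _ := by unfold width; nlinarith

/-- A seed of at least `64` outweighs the admitted error of `64` standard deviations for all items
at once. -/
lemma Accurate.le_thompson {w : Fin L → ℝ} {t : ℕ} {s : Stats L} (h : Accurate w t s)
    {z : ℝ} (hz : 64 ≤ z) (i : Fin L) : w i ≤ s.thompson t z i := by
  have h0 := s.stdDev_nonneg t i
  have h1 := (abs_le.1 (h i)).1
  unfold Stats.thompson
  nlinarith

/-- Among the greedy lists for seeds in `[64, 65]`, one has the smallest width. -/
lemma exists_optimistic_list (hKL : K ≤ L) (w : Fin L → ℝ) (t : ℕ) (s : Stats L) :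
    ∃ a : Fin K → Fin L, (∃ z ∈ Set.Icc (64 : ℝ) 65, IsGreedyList (s.thompson t z) a) ∧
      ∀ b : Fin K → Fin L, (∃ z ∈ Set.Icc (64 : ℝ) 65, IsGreedyList (s.thompson t z) b) →
        listWidth w t s a ≤ listWidth w t s b := by
  obtain ⟨a, ha⟩ := exists_isGreedyList hKL (s.thompson t 64)
  obtain ⟨b, hb, hmin⟩ := Set.exists_min_image
    {a : Fin K → Fin L | ∃ z ∈ Set.Icc (64 : ℝ) 65, IsGreedyList (s.thompson t z) a}
    (listWidth w t s) (Set.toFinite _) ⟨a, 64, ⟨le_rfl, by norm_num⟩, ha⟩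
  exact ⟨b, hb, hmin⟩

namespace IsTSCascade

variable {Ω : Type*} [MeasurableSpace Ω] {μ : Measure Ω} [IsProbabilityMeasure μ] {w : Fin L → ℝ}
  {Z : ℕ → Ω → ℝ} {S : ℕ → Ω → Fin K → Fin L} {W : ℕ → Ω → Fin L → Bool}

omit [IsProbabilityMeasure μ] in
lemma measureReal_seed (h : IsTSCascade μ w Z S W) {t : ℕ} (ht : 1 ≤ t) {A : Set ℝ}
    (hA : MeasurableSet A) : μ.real (Z t ⁻¹' A) = (gaussianReal 0 1).real A := by
  rw [← h.seed_law t ht, map_measureReal_apply (h.measurable_seed t ht) hA]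

omit [IsProbabilityMeasure μ] in
lemma measure_seed_large_le (h : IsTSCascade μ w Z S W) {t : ℕ} (ht : 1 ≤ t) :
    μ.real {ω | 100 * Real.sqrt (Real.log ((t : ℝ) + 1)) < |Z t ω|} ≤ 2 / ((t : ℝ) + 1) ^ 2 := by
  have hl := log_add_one_nonneg t
  have h1 := h.measureReal_seed ht (A := {x | 100 * Real.sqrt (Real.log ((t : ℝ) + 1)) < |x|})
    (measurableSet_lt measurable_const measurable_abs)
  refine (le_of_eq h1).trans ((gaussianReal_tail_le (by positivity)).trans ?_)
  rw [div_eq_mul_inv]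
  refine mul_le_mul_of_nonneg_left ?_ (by norm_num)
  rw [← Real.exp_log (show 0 < (((t : ℝ) + 1) ^ 2)⁻¹ by positivity), Real.exp_le_exp,
    Real.log_inv, Real.log_pow, mul_pow, Real.sq_sqrt hl]
  push_cast
  linarith

/-- The minimal width of optimistic lists is controlled by the width of the shown list. -/
lemma integral_optimistic_le (h : IsTSCascade μ w Z S W) (hw : ∀ i, w i ∈ Set.Icc (0 : ℝ) 1)
    {t : ℕ} (ht : 1 ≤ t) {a : Stats L → Fin K → Fin L}
    (ha : ∀ s, ∀ b : Fin K → Fin L,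
      (∃ z ∈ Set.Icc (64 : ℝ) 65, IsGreedyList (s.thompson t z) b) →
        listWidth w t s (a s) ≤ listWidth w t s b) :
    (∫ ω, listWidth w t (runStats S W t ω) (a (runStats S W t ω)) ∂μ) *
        (gaussianReal 0 1).real (Set.Icc 64 65) ≤
      ∫ ω, listWidth w t (runStats S W t ω) (S t ω) ∂μ := by
  have hZ : Measurable[MeasurableSpace.comap (Z t) inferInstance]
      fun ω => (Z t ⁻¹' Set.Icc 64 65).indicator (fun _ => (1 : ℝ)) ω :=
    Measurable.indicator measurable_const ⟨Set.Icc 64 65, measurableSet_Icc, rfl⟩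
  have hZ' : MeasurableSet (Z t ⁻¹' Set.Icc 64 65) := h.measurable_seed t ht measurableSet_Icc
  have hm : FiniteValued (past Z S W t)
      fun ω => listWidth w t (runStats S W t ω) (a (runStats S W t ω)) :=
    (finiteValued_runStats t).comp fun s => listWidth w t s (a s)
  have hmi := (hm.mono (h.past_le t)).integrable (μ := μ)
  have hZi : Integrable (fun ω => (Z t ⁻¹' Set.Icc 64 65).indicator (fun _ => (1 : ℝ)) ω) μ :=
    (integrable_const _).indicator hZ'
  have hind : IndepFun (fun ω => listWidth w t (runStats S W t ω) (a (runStats S W t ω)))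
      (fun ω => (Z t ⁻¹' Set.Icc 64 65).indicator (fun _ => (1 : ℝ)) ω) μ := by
    rw [IndepFun_iff_Indep]
    exact indep_of_indep_of_le_left (indep_of_indep_of_le_right (h.seed_indep t ht) hZ.comap_le)
      hm.measurable.comap_le
  have e : ∫ ω, (Z t ⁻¹' Set.Icc 64 65).indicator (fun _ => (1 : ℝ)) ω ∂μ =
      (gaussianReal 0 1).real (Set.Icc 64 65) := by
    rw [integral_indicator_const _ hZ', h.measureReal_seed ht measurableSet_Icc, smul_eq_mul,
      mul_one]
  rw [← e, ← hind.integral_fun_mul_eq_mul_integral hmi.aestronglyMeasurable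
    hZi.aestronglyMeasurable]
  refine integral_mono (hind.integrable_mul hmi hZi)
    (h.integrable_list ht fun s b => listWidth w t s b) fun ω => ?_
  -- For such a seed the shown list, however ties were broken, competes in the minimum defining `a`.
  by_cases hω : Z t ω ∈ Set.Icc (64 : ℝ) 65
  · simp only [Set.indicator, Set.mem_preimage, hω, if_true, mul_one]
    exact ha _ _ ⟨Z t ω, hω, h.list_greedy t ht ω⟩
  · simp only [Set.indicator, Set.mem_preimage, hω, if_false, mul_zero]
    exact listWidth_nonneg hw _ _ _

lemma integral_gap_le (h : IsTSCascade μ w Z S W) (hKL : K ≤ L)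
    (hw : ∀ i, w i ∈ Set.Icc (0 : ℝ) 1) {t : ℕ} (ht : 1 ≤ t) :
    ∫ ω, (optimalReward K w - expectedReward w (S t ω)) ∂μ ≤
      (2 * L + 2) * (1 / ((t : ℝ) + 1) ^ 2) +
        (1 + 2 / (gaussianReal 0 1).real (Set.Icc 64 65)) *
          ∫ ω, listWidth w t (runStats S W t ω) (S t ω) ∂μ := by
  set p := (gaussianReal 0 1).real (Set.Icc 64 65)
  have hp : 0 < p := gaussianReal_Icc_pos (by norm_num)
  choose a ha hamin using exists_optimistic_list hKL w t
  set b := 100 * Real.sqrt (Real.log ((t : ℝ) + 1)) with hb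
  set A : Set Ω := {ω | ¬ Accurate w t (runStats S W t ω)} with hA
  set B : Set Ω := {ω | b < |Z t ω|} with hB
  have hAm : MeasurableSet A := (h.finiteValued_stats t).2 {s | ¬ Accurate w t s}
  have hBm : MeasurableSet B :=
    measurableSet_lt measurable_const (measurable_abs.comp (h.measurable_seed t ht))
  have hopt1 : optimalReward K w ≤ 1 := optimalReward_le hKL fun S => expectedReward_le_one hw S
  have pointwise : ∀ ω, optimalReward K w - expectedReward w (S t ω) ≤
      (A.indicator (fun _ => (1 : ℝ)) ω + B.indicator (fun _ => (1 : ℝ)) ω) +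
        (listWidth w t (runStats S W t ω) (S t ω) +
          2 * listWidth w t (runStats S W t ω) (a (runStats S W t ω))) := by
    intro ω
    have n1 := listWidth_nonneg hw t (runStats S W t ω) (S t ω)
    have n2 := listWidth_nonneg hw t (runStats S W t ω) (a (runStats S W t ω))
    have n3 : 0 ≤ A.indicator (fun _ => (1 : ℝ)) ω := Set.indicator_nonneg (fun _ _ => zero_le_one) ω
    have n4 : 0 ≤ B.indicator (fun _ => (1 : ℝ)) ω := Set.indicator_nonneg (fun _ _ => zero_le_one) ω
    -- On either exceptional event the indicator alone pays for the gap, which is at most `1`.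
    have n5 := expectedReward_nonneg hw (S t ω)
    by_cases hωA : ω ∈ A
    · rw [Set.indicator_of_mem hωA]; linarith
    by_cases hωB : ω ∈ B
    · rw [Set.indicator_of_mem hωB]; linarith
    have hacc : Accurate w t (runStats S W t ω) := not_not.1 hωA
    have hz : |Z t ω| ≤ b := not_lt.1 hωB
    obtain ⟨z, hz1, hz2⟩ := ha (runStats S W t ω)
    have hz' : |z| ≤ b := by
      rw [abs_of_nonneg (by linarith [hz1.1])]
      -- Here `65 ≤ 100 · 4/5`.
      linarith [hz1.2, sqrt_log_ge ht]
    have := optimalReward_sub_expectedReward_le hKL hw (h.list_greedy t ht ω) hz2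
      (hacc.le_thompson hz1.1) (hacc.abs_thompson_sub_le ht hz) (hacc.abs_thompson_sub_le ht hz')
    unfold listWidth at *
    linarith
  have i1 : Integrable (A.indicator fun _ => (1 : ℝ)) μ := (integrable_const _).indicator hAm
  have i2 : Integrable (B.indicator fun _ => (1 : ℝ)) μ := (integrable_const _).indicator hBm
  have i3 : Integrable (fun ω => listWidth w t (runStats S W t ω) (S t ω)) μ :=
    h.integrable_list ht fun s b => listWidth w t s b
  have i4 : Integrable (fun ω => listWidth w t (runStats S W t ω) (a (runStats S W t ω))) μ :=
    h.integrable_list ht fun s _ => listWidth w t s (a s)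
  have key := integral_mono (μ := μ)
    (h.integrable_list ht fun _ c => optimalReward K w - expectedReward w c)
    ((i1.add i2).add (i3.add (i4.const_mul 2))) pointwise
  refine key.trans ?_
  rw [integral_add' (i1.add i2) (i3.add (i4.const_mul 2)), integral_add' i1 i2,
    integral_add' i3 (i4.const_mul 2), integral_const_mul, integral_indicator_const _ hAm,
    integral_indicator_const _ hBm, smul_eq_mul, smul_eq_mul, mul_one, mul_one]
  have b1 := h.measure_not_accurate_le hw ht
  have b2 := h.measure_seed_large_le ht
  have b3 := h.integral_optimistic_le hw ht hamin
  rw [← le_div_iff₀ hp] at b3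
  have e1 : (2 * (L : ℝ) + 2) * (1 / ((t : ℝ) + 1) ^ 2) =
    2 * L / ((t : ℝ) + 1) ^ 2 + 2 / ((t : ℝ) + 1) ^ 2 := by ring
  have e2 : ∀ x : ℝ, (1 + 2 / p) * x = x + 2 * (x / p) := fun x => by ring
  rw [e1, e2]
  linarith

/-! ### Summation over the rounds -/

omit [IsProbabilityMeasure μ] in
lemma regret_eq_sum (w : Fin L → ℝ) (S : ℕ → Fin K → Fin L) (T : ℕ) :
    regret w S T = ∑ t ∈ Finset.Icc 1 T, (optimalReward K w - expectedReward w (S t)) := by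
  simp [regret]

lemma integrable_regret (h : IsTSCascade μ w Z S W) (T : ℕ) :
    Integrable (fun ω => regret w (fun t => S t ω) T) μ := by
  simp only [regret_eq_sum]
  exact integrable_finsetSum _ fun t ht =>
    h.integrable_list (Finset.mem_Icc.1 ht).1 fun _ c => optimalReward K w - expectedReward w c

lemma sum_inv_sq_le (T : ℕ) : ∑ t ∈ Finset.Icc 1 T, 1 / ((t : ℝ) + 1) ^ 2 ≤ 1 - 1 / ((T : ℝ) + 1) := by
  induction T with
  | zero => simp
  | succ T ih =>
    rw [Finset.sum_Icc_succ_top (by omega)]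
    push_cast
    have hT : (0 : ℝ) ≤ T := Nat.cast_nonneg T
    have : 1 / ((T : ℝ) + 1 + 1) ^ 2 ≤ 1 / ((T : ℝ) + 1) - 1 / ((T : ℝ) + 1 + 1) := by
      rw [div_sub_div _ _ (by positivity) (by positivity), div_le_div_iff₀ (by positivity)
        (by positivity)]
      nlinarith
    linarith

lemma integral_regret_le (h : IsTSCascade μ w Z S W) (hKL : K ≤ L)
    (hw : ∀ i, w i ∈ Set.Icc (0 : ℝ) 1) (T : ℕ) :
    ∫ ω, regret w (fun t => S t ω) T ∂μ ≤ (2 * L + 2) +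
      (1 + 2 / (gaussianReal 0 1).real (Set.Icc 64 65)) * (200 *
        (Real.log ((T : ℝ) + 1) * (2 * Real.sqrt ((K : ℝ) * L * T)) +
          Real.sqrt (Real.log ((T : ℝ) + 1)) * Real.log ((T : ℝ) + 1) * (L * (1 + Real.log T)))) := by
  classical
  set c := 1 + 2 / (gaussianReal 0 1).real (Set.Icc 64 65)
  have hc : 0 ≤ c := by positivity
  have hint : ∀ t ∈ Finset.Icc 1 T, Integrable (fun ω => ∑ i,
      (if Observed (S t ω) (W t ω) i then width t (runStats S W t ω) i else 0)) μ := fun t ht =>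
    h.integrable_round (Finset.mem_Icc.1 ht).1 fun s b v =>
      ∑ i, (if Observed b v i then width t s i else 0)
  simp only [regret_eq_sum]
  rw [integral_finsetSum _ fun t ht => h.integrable_list (Finset.mem_Icc.1 ht).1
    fun _ c => optimalReward K w - expectedReward w c]
  refine (Finset.sum_le_sum fun t ht =>
    h.integral_gap_le hKL hw (Finset.mem_Icc.1 ht).1).trans ?_
  rw [Finset.sum_add_distrib, ← Finset.mul_sum, ← Finset.mul_sum]
  refine add_le_add ?_ (mul_le_mul_of_nonneg_left ?_ hc)
  · have h1 := sum_inv_sq_le T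
    have h2 : (0 : ℝ) ≤ 1 / ((T : ℝ) + 1) := by positivity
    exact mul_le_of_le_one_right (by positivity) (by linarith)
  · simp only [listWidth]
    rw [Finset.sum_congr rfl fun t ht =>
      h.integral_sum_reachProb (Finset.mem_Icc.1 ht).1 hw (width t), ← integral_finsetSum _ hint]
    refine (integral_mono (integrable_finsetSum _ hint) (integrable_const (200 *
        (Real.log ((T : ℝ) + 1) * (2 * Real.sqrt ((K : ℝ) * L * T)) +
          Real.sqrt (Real.log ((T : ℝ) + 1)) * Real.log ((T : ℝ) + 1) *
            (L * (1 + Real.log T))))) fun ω => ?_).trans_eq (by simp)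
    have := sum_observed_stdDev_le (fun t => S t ω) (fun t => W t ω) T
    refine le_trans (le_of_eq ?_) (mul_le_mul_of_nonneg_left this (by norm_num))
    simp only [Finset.mul_sum, mul_ite, mul_zero, width]

end IsTSCascade

/-- Used with `R = √(KLT)`, `x = log T` and `ℓ = log (T + 1)`. Since `x ≥ 1/2`, constants are
absorbed through `1 + x ≤ 3x` and `x² √x ≥ 1/8`. -/
lemma regret_bound_simplify {L R c x ℓ : ℝ} (hL : 1 ≤ L) (hR : 0 ≤ R) (hc : 0 ≤ c)
    (hx : 1 / 2 ≤ x) (hℓ0 : 0 ≤ ℓ) (hℓ : ℓ ≤ 2 * x) :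
    (2 * L + 2) + c * (200 * (ℓ * (2 * R) + Real.sqrt ℓ * ℓ * (L * (1 + x)))) ≤
      (32 + 2400 * c) * (R * x + L * x ^ (5 / 2 : ℝ)) := by
  have hx0 : 0 < x := by linarith
  have hpow : x ^ (5 / 2 : ℝ) = x ^ 2 * Real.sqrt x := by
    rw [show (5 / 2 : ℝ) = 2 + 1 / 2 by norm_num, Real.rpow_add hx0, Real.sqrt_eq_rpow,
      Real.rpow_two]
  have hs0 := Real.sqrt_nonneg x
  have hs : 1 / 2 ≤ Real.sqrt x := Real.le_sqrt_of_sq_le (by linarith)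
  have hsℓ : Real.sqrt ℓ ≤ 2 * Real.sqrt x := by
    refine Real.sqrt_le_iff.2 ⟨by positivity, ?_⟩
    rw [mul_pow, Real.sq_sqrt hx0.le]; linarith
  rw [hpow]
  set q := Real.sqrt x
  have hq : 1 / 8 ≤ x ^ 2 * q := by nlinarith
  have t1 : 2 * L + 2 ≤ 32 * (L * (x ^ 2 * q)) := by nlinarith
  have t2 : Real.sqrt ℓ * ℓ * (L * (1 + x)) ≤ 12 * (L * (x ^ 2 * q)) := by
    calc _ ≤ 2 * q * (2 * x) * (L * (3 * x)) := by gcongr; linarith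
      _ = _ := by ring
  have t3 : ℓ * (2 * R) ≤ 12 * (R * x) := by nlinarith
  have t4 : c * (200 * (ℓ * (2 * R) + Real.sqrt ℓ * ℓ * (L * (1 + x)))) ≤
      c * (200 * (12 * (R * x) + 12 * (L * (x ^ 2 * q)))) := by gcongr
  have t5 : 0 ≤ R * x := by positivity
  linarith

end CascadingBandit

theorem theorem1 :
    ∃ C : ℝ, 0 < C ∧
      ∀ (L K T : ℕ), K ≤ L → 2 ≤ T →
      ∀ (w : Fin L → ℝ), (∀ i, w i ∈ Set.Icc (0 : ℝ) 1) →
      ∀ (Ω : Type*) [MeasurableSpace Ω] (μ : Measure Ω) [IsProbabilityMeasure μ]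
        (Z : ℕ → Ω → ℝ) (S : ℕ → Ω → Fin K → Fin L) (W : ℕ → Ω → Fin L → Bool),
        CascadingBandit.IsTSCascade μ w Z S W →
          Integrable (fun ω => CascadingBandit.regret w (fun t => S t ω) T) μ ∧
          ∫ ω, CascadingBandit.regret w (fun t => S t ω) T ∂μ ≤
            C * (Real.sqrt ((K : ℝ) * L * T) * Real.log T + L * Real.log T ^ (5 / 2 : ℝ)) := by
  set c := 1 + 2 / (gaussianReal 0 1).real (Set.Icc 64 65)
  have hc : 0 ≤ c := by positivity
  refine ⟨32 + 2400 * c, by positivity, ?_⟩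
  intro L K T hKL hT w hw Ω _ μ _ Z S W h
  refine ⟨h.integrable_regret T, ?_⟩
  have hT' : (2 : ℝ) ≤ T := by exact_mod_cast hT
  have hlog : Real.log 2 ≤ Real.log T := Real.log_le_log (by norm_num) hT'
  have hlog2 := Real.log_two_gt_d9
  rcases Nat.eq_zero_or_pos L with rfl | hL
  · obtain rfl : K = 0 := by omega
    simp [CascadingBandit.regret, CascadingBandit.optimalReward, CascadingBandit.expectedReward]
  · refine (h.integral_regret_le hKL hw T).trans (CascadingBandit.regret_bound_simplify
      (by exact_mod_cast hL) (Real.sqrt_nonneg _) hc (by linarith)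
      (CascadingBandit.log_add_one_nonneg T) ?_)
    -- For `T ≥ 2` one has `T + 1 ≤ T²`.
    rw [show 2 * Real.log (T : ℝ) = Real.log ((T : ℝ) ^ 2) by rw [Real.log_pow]; norm_num]
    exact Real.log_le_log (by positivity) (by nlinarith)
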